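/- A dimension group is a partially ordered abelian group $G$ that is directed ($G=G^+-G^+$), unperforated ($ng\ge 0$ with $n\ge 1$ implies $g\ge 0$) and has the Riesz interpolation property. An order unit is an element $u\in G^+$ such that every $g\in G$ satisfies $g\le nu$ for some $n\in\mathbf N$. A trace on $G$ is a nonzero group homomorphism $t:G\to\mathbf R$ with $t(G^+)\subseteq[0,\infty)$. It is faithful if $\ker t\cap G^+=\{0\}$, and good if $t([0,b])=t(G)\cap[0,t(b)]$ for every $b\in G^+$, where $[0,b]=\{g\in G: 0\le g\le b\}$. An ECS (equal column sum) realization of $G$ is an isomorphism of ordered groups from $G$ onto a direct limit $\varinjlim M_i:\mathbf Z^{n(i)}\to\mathbf Z^{n(i+1)}$ ($i=1,2,\dots$, $n(i)\ge 1$), with the coordinatewise order on each $\mathbf Z^{n(i)}$ and the direct limit order on the limit, where each $M_i$ is a matrix of nonnegative integers all of whose columns have the same sum $c_i\ge 1$. Its associated trace $\tau$ is given by $\tau([w,j])=\mathbf 1^T w/\prod_{i=1}^{j-1}c_i$ for $w\in\mathbf Z^{n(j)}$. The realization implements a trace $t$ if $t=q\tau$ for some rational $q>0$. Theorem 6.1.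 Let $G$ be a dimension group with order unit and let $t$ be a trace on $G$. (a) If some ECS realization of $G$ implements $t$ (in particular, if $t$ is its associated trace), then $t$ is faithful, good and rational-valued. (b) If $G$ is countable, $t(G)\subseteq\mathbf Q$, and $t$ is faithful and good, then there is an ECS realization of $G$ that implements $t$. If moreover $1\in t(G)$ (for example, if $t$ is normalized at an order unit), the realization can be chosen so that $t$ is exactly its associated trace. -/

import Mathlib

/-- A dimension group: a partially ordered abelian group which is directed (every element is a
difference of positive elements), unperforated (hence torsion-free), and has the Riesz
interpolation property. -/
structure IsDimensionGroup (G : Type*) [AddCommGroup G] [PartialOrder G] [IsOrderedAddMonoid G] :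
    Prop where
  directed : ∀ g : G, ∃ a b : G, 0 ≤ a ∧ 0 ≤ b ∧ g = a - b
  unperforated : ∀ (n : ℕ) (g : G), 0 < n → 0 ≤ n • g → 0 ≤ g
  interpolation : ∀ a₁ a₂ b₁ b₂ : G, a₁ ≤ b₁ → a₁ ≤ b₂ → a₂ ≤ b₁ → a₂ ≤ b₂ →
    ∃ c : G, a₁ ≤ c ∧ a₂ ≤ c ∧ c ≤ b₁ ∧ c ≤ b₂

/-- `u` is an order unit: a positive element whose multiples dominate every element. -/
def IsOrderUnit {G : Type*} [AddCommGroup G] [PartialOrder G] (u : G) : Prop :=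
  0 ≤ u ∧ ∀ g : G, ∃ n : ℕ, g ≤ n • u

/-- A trace: a nonzero positive group homomorphism to the reals (no normalization). -/
def IsTrace {G : Type*} [AddCommGroup G] [PartialOrder G] (t : G →+ ℝ) : Prop :=
  (∀ g : G, 0 ≤ g → 0 ≤ t g) ∧ t ≠ 0

/-- A faithful trace: its kernel meets the positive cone only in zero. -/
def IsFaithfulTrace {G : Type*} [AddCommGroup G] [PartialOrder G] (t : G →+ ℝ) : Prop :=
  ∀ g : G, 0 ≤ g → t g = 0 → g = 0

/-- A good trace: `t([0, b]) = t(G) ∩ [0, t(b)]` for every positive `b`. -/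
def IsGoodTrace {G : Type*} [AddCommGroup G] [PartialOrder G] (t : G →+ ℝ) : Prop :=
  ∀ b : G, 0 ≤ b → t '' Set.Icc 0 b = Set.range t ∩ Set.Icc 0 (t b)

/-- A trace all of whose values are rational. -/
def IsRationalTrace {G : Type*} [AddCommGroup G] (t : G →+ ℝ) : Prop :=
  ∀ g : G, ∃ r : ℚ, t g = (r : ℝ)

/-- A sequence `ℤ^{f 0} → ℤ^{f 1} → ⋯` of simplicial groups of positive ranks, the `i`-th map
being given by an `f (i + 1) × f i` matrix of nonnegative integers. -/
structure SimplicialSequence where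
  size : ℕ → ℕ
  size_pos : ∀ i, 0 < size i
  mat : ∀ i, Matrix (Fin (size (i + 1))) (Fin (size i)) ℕ

namespace SimplicialSequence

variable (S : SimplicialSequence)

/-- The `i`-th simplicial group; functions carry the coordinatewise order. -/
abbrev Level (i : ℕ) : Type := Fin (S.size i) → ℤ

/-- The `i`-th connecting map `v ↦ M_i v`. -/
def step (i : ℕ) : S.Level i →+ S.Level (i + 1) :=
  ((S.mat i).map (Nat.cast : ℕ → ℤ)).mulVecLin.toAddMonoidHom

/-- The composite map `M_{j-1} ⋯ M_i` from level `i` to level `j`. -/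
def trans (i j : ℕ) (h : i ≤ j) : S.Level i →+ S.Level j :=
  Nat.leRec (motive := fun k _ => S.Level i →+ S.Level k) (AddMonoidHom.id _)
    (fun k _ f => (S.step k).comp f) h

theorem trans_self (i : ℕ) : S.trans i i le_rfl = AddMonoidHom.id _ := by
  simp [trans, Nat.leRec_self]

theorem trans_succ {i j : ℕ} (h : i ≤ j) :
    S.trans i (j + 1) (Nat.le_succ_of_le h) = (S.step j).comp (S.trans i j h) := by
  exact Nat.leRec_succ (motive := fun k _ => S.Level i →+ S.Level k) _ _ _

theorem trans_trans {i j k : ℕ} (hij : i ≤ j) (hjk : j ≤ k) (v : S.Level i) :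
    S.trans j k hjk (S.trans i j hij v) = S.trans i k (hij.trans hjk) v := by
  induction hjk with
  | refl => simp [trans_self]
  | step h ih =>
    rw [S.trans_succ h, S.trans_succ (hij.trans h)]
    simp only [AddMonoidHom.comp_apply, ih]

theorem step_nonneg (i : ℕ) {v : S.Level i} (hv : 0 ≤ v) : 0 ≤ S.step i v := by
  intro r
  have h : S.step i v r = ∑ j, (S.mat i r j : ℤ) * v j := rfl
  rw [h]
  exact Finset.sum_nonneg fun j _ => mul_nonneg (Int.natCast_nonneg _) (hv j)

theorem trans_nonneg {i j : ℕ} (h : i ≤ j) {v : S.Level i} (hv : 0 ≤ v) :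
    0 ≤ S.trans i j h v := by
  induction h with
  | refl => simpa [trans_self] using hv
  | step h ih =>
    rw [S.trans_succ h]
    exact S.step_nonneg _ ih

instance : DirectedSystem S.Level (S.trans · · ·) where
  map_self i x := by simp [trans_self]
  map_map _ _ _ hij hjk x := S.trans_trans hij hjk x

/-- The direct limit of the sequence, as an abelian group. -/
def Limit : Type := DirectLimit S.Level S.trans

noncomputable instance : AddCommGroup S.Limit :=
  inferInstanceAs (AddCommGroup (DirectLimit S.Level S.trans))

/-- The class `[v, i]` of `v ∈ ℤ^{f i}` in the direct limit. -/
def cls (i : ℕ) (v : S.Level i) : S.Limit :=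
  (⟦⟨i, v⟩⟧ : DirectLimit S.Level S.trans)

theorem cls_add (i : ℕ) (v w : S.Level i) : S.cls i (v + w) = S.cls i v + S.cls i w :=
  (DirectLimit.add_def (f := S.trans) i v w).symm

theorem cls_neg (i : ℕ) (v : S.Level i) : S.cls i (-v) = -S.cls i v := rfl

theorem cls_zero (i : ℕ) : S.cls i 0 = 0 :=
  (DirectLimit.zero_def (f := S.trans) i).symm

theorem cls_trans {i j : ℕ} (h : i ≤ j) (v : S.Level i) : S.cls j (S.trans i j h v) = S.cls i v :=
  DirectLimit.mk_apply (f := S.trans) i j v h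

theorem cls_eq_zero {i : ℕ} {v : S.Level i} (h : S.cls i v = 0) :
    ∃ j, ∃ hij : i ≤ j, S.trans i j hij v = 0 :=
  (DirectLimit.exists_eq_zero (f := S.trans) ⟨i, v⟩).1 h

/-- The positive cone of the direct limit: classes of coordinatewise nonnegative vectors. -/
def Pos (x : S.Limit) : Prop := ∃ (i : ℕ) (v : S.Level i), 0 ≤ v ∧ x = S.cls i v

theorem Pos.add {S : SimplicialSequence} {x y : S.Limit} (hx : S.Pos x) (hy : S.Pos y) :
    S.Pos (x + y) := by
  obtain ⟨i, v, hv, rfl⟩ := hx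
  obtain ⟨j, w, hw, rfl⟩ := hy
  refine ⟨max i j, S.trans i _ (le_max_left i j) v + S.trans j _ (le_max_right i j) w,
    add_nonneg (S.trans_nonneg _ hv) (S.trans_nonneg _ hw), ?_⟩
  rw [cls_add, cls_trans, cls_trans]

theorem Pos.eq_zero {S : SimplicialSequence} {x : S.Limit} (hx : S.Pos x) (hy : S.Pos (-x)) :
    x = 0 := by
  obtain ⟨i, v, hv, rfl⟩ := hx
  obtain ⟨j, w, hw, h⟩ := hy
  have h0 : S.cls (max i j)
      (S.trans i _ (le_max_left i j) v + S.trans j _ (le_max_right i j) w) = 0 := by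
    rw [cls_add, cls_trans, cls_trans, ← h, add_neg_cancel]
  obtain ⟨k, hk, h1⟩ := S.cls_eq_zero h0
  rw [map_add, trans_trans, trans_trans] at h1
  have h2 := (add_eq_zero_iff_of_nonneg (S.trans_nonneg _ hv) (S.trans_nonneg _ hw)).1 h1
  rw [← S.cls_trans ((le_max_left i j).trans hk) v, h2.1, cls_zero]

/-- The direct limit order: `x ≤ y` iff `y - x` is the class of a nonnegative vector. -/
instance : PartialOrder S.Limit where
  le x y := S.Pos (y - x)
  le_refl x := ⟨0, 0, le_rfl, by rw [sub_self, cls_zero]⟩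
  le_trans x y z hxy hyz := by simpa using hyz.add hxy
  le_antisymm x y hxy hyx := by
    have := hxy.eq_zero (by simpa using hyx)
    exact (sub_eq_zero.1 this).symm

theorem le_iff {x y : S.Limit} : x ≤ y ↔ S.Pos (y - x) := Iff.rfl

instance : IsOrderedAddMonoid S.Limit where
  add_le_add_left x y h z := by
    rw [le_iff] at h ⊢
    simpa using h

end SimplicialSequence

/-- A sequence of simplicial groups in which, for each `i`, all column sums of the `i`-th matrix
are equal to one and the same positive integer `colSum i`. -/
structure ECSSequence extends SimplicialSequence where
  colSum : ℕ → ℕ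
  colSum_pos : ∀ i, 0 < colSum i
  sum_col : ∀ (i : ℕ) (j : Fin (size i)), ∑ r, mat i r j = colSum i

namespace ECSSequence

variable (E : ECSSequence)

/-- The normalized constant row at level `j`: `v ↦ (∑ₖ v_k) / ∏_{i < j} c_i`. -/
noncomputable def levelTrace (j : ℕ) : E.Level j →+ ℝ where
  toFun v := ((∑ k, v k : ℤ) : ℝ) / ∏ i ∈ Finset.range j, (E.colSum i : ℝ)
  map_zero' := by simp
  map_add' v w := by
    simp only [Pi.add_apply, Finset.sum_add_distrib, Int.cast_add, add_div]

theorem sum_step (j : ℕ) (v : E.Level j) : ∑ r, E.step j v r = E.colSum j * ∑ k, v k := by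
  simp only [SimplicialSequence.step, LinearMap.toAddMonoidHom_coe, Matrix.mulVecLin_apply,
    Matrix.mulVec, dotProduct, Matrix.map_apply]
  rw [Finset.sum_comm, Finset.mul_sum]
  refine Finset.sum_congr rfl fun k _ => ?_
  rw [← Finset.sum_mul, ← E.sum_col j k, Nat.cast_sum]

theorem levelTrace_step (j : ℕ) (v : E.Level j) :
    E.levelTrace (j + 1) (E.step j v) = E.levelTrace j v := by
  have h : (E.colSum j : ℝ) ≠ 0 := by exact_mod_cast (E.colSum_pos j).ne'
  simp only [levelTrace, AddMonoidHom.coe_mk, ZeroHom.coe_mk, E.sum_step, Finset.prod_range_succ]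
  push_cast
  rw [mul_comm (∏ i ∈ Finset.range j, (E.colSum i : ℝ)), mul_div_mul_left _ _ h]

theorem levelTrace_trans {i j : ℕ} (h : i ≤ j) (v : E.Level i) :
    E.levelTrace i v = E.levelTrace j (E.trans i j h v) := by
  induction h with
  | refl => simp [SimplicialSequence.trans_self]
  | step h ih =>
    rw [E.trans_succ h, AddMonoidHom.comp_apply, levelTrace_step, ih]

/-- The trace associated to the sequence: `[v, j] ↦ (∑ₖ v_k) / ∏_{i < j} c_i`. -/
noncomputable def trace : E.Limit →+ ℝ where
  toFun x := DirectLimit.lift E.trans (fun i v => E.levelTrace i v)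
    (fun _ _ h v => E.levelTrace_trans h v) x
  map_zero' := DirectLimit.lift_zero (f := E.trans) E.levelTrace
    (fun _ _ h v => E.levelTrace_trans h v)
  map_add' x y := DirectLimit.lift_add (f := E.trans) E.levelTrace
    (fun _ _ h v => E.levelTrace_trans h v) x y

theorem trace_cls (j : ℕ) (v : E.Level j) :
    E.trace (E.cls j v) = ((∑ k, v k : ℤ) : ℝ) / ∏ i ∈ Finset.range j, (E.colSum i : ℝ) := rfl

end ECSSequence

/-- An ECS realization of the ordered group `G`: an isomorphism of ordered groups from `G` onto
the direct limit of a sequence of simplicial groups by matrices with equal column sums. -/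
structure ECSRealization (G : Type*) [AddCommGroup G] [PartialOrder G] where
  seq : ECSSequence
  iso : G ≃+o seq.Limit

/-- The trace on `G` associated to an ECS realization of `G`. -/
noncomputable def ECSRealization.trace {G : Type*} [AddCommGroup G] [PartialOrder G]
    (R : ECSRealization G) : G →+ ℝ :=
  R.seq.trace.comp R.iso.toAddEquiv.toAddMonoidHom

/-! On `ℤⁿ` the coordinate sum is faithful on nonnegative vectors, and below a nonnegative vector it
attains every integer from 0 to the sum of that vector. Equal column sums make these functionals,
divided by the products of the `c_i`, compatible along the sequence. Any two elements of the limit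
live at a common level, so the associated trace is faithful, good and rational, and so are its
positive rational multiples.

Conversely, `G` is exhausted by finite positive families, each expressed through the next by a
matrix over `ℕ`. Three things are needed at each stage (`TracedFamily.exists_next`). Relations must
die: this is Shen's argument, by Riesz decomposition and unperforation (`exists_refines_card_lt`,
`exists_refines_ker`). A prescribed positive element must be represented: it is adjoined to the
family. All members must have the same trace: finitely many rational values of `t` are multiples of
one `h > 0` in `t(G)`, and goodness cuts an element of trace `n * h` into pieces of trace `h`,
faithfulness ensuring that nothing is left over (`exists_sum_eq`).

Once traces are constant on each family, applying `t` to the refinement identities shows that all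
column sums agree (`TracedFamily.sum_col`). The limit of the resulting sequence is `G`
(`exists_orderAddMonoidIso`), and the column sums telescope to identify the trace. -/

/-! ### Riesz decomposition. -/

section Riesz

variable {G : Type*} [AddCommGroup G] [PartialOrder G] [IsOrderedAddMonoid G]

/-- Riesz decomposition over a finite set. -/
theorem IsDimensionGroup.exists_decomposition (hG : IsDimensionGroup G) {ι : Type*}
    [DecidableEq ι] (J : Finset ι) (x : ι → G) (hx : ∀ i, 0 ≤ x i) (a : G) (ha : 0 ≤ a)
    (hle : a ≤ ∑ i ∈ J, x i) :
    ∃ y : ι → G, (∀ i, 0 ≤ y i) ∧ (∀ i, y i ≤ x i) ∧ (∀ i, i ∉ J → y i = 0) ∧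
      a = ∑ i ∈ J, y i := by
  induction J using Finset.induction_on generalizing a with
  | empty =>
    refine ⟨0, fun _ => le_rfl, hx, fun _ _ => rfl, ?_⟩
    simpa using le_antisymm (by simpa using hle) ha
  | insert j J hj ih =>
    rw [Finset.sum_insert hj] at hle
    have hs : 0 ≤ ∑ i ∈ J, x i := Finset.sum_nonneg fun i _ => hx i
    -- `c` is the share of `a` placed under `x j`; the lower bound `a - ∑ i ∈ J, x i` keeps the
    -- remainder `a - c` below the other summands.
    obtain ⟨c, h0c, hc1, hca, hcx⟩ := hG.interpolation 0 (a - ∑ i ∈ J, x i) a (x j) ha (hx j)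
      (sub_le_self _ hs) (sub_le_iff_le_add.2 hle)
    obtain ⟨y, hy0, hyx, hyJ, hsum⟩ := ih (a - c) (sub_nonneg.2 hca)
      (by rw [sub_le_iff_le_add] at hc1 ⊢; rwa [add_comm])
    have hne : ∀ i ∈ J, i ≠ j := fun i hi h => hj (h ▸ hi)
    refine ⟨Function.update y j c, fun i => ?_, fun i => ?_, fun i hi => ?_, ?_⟩
    · by_cases h : i = j
      · subst h; simpa using h0c
      · simpa [h] using hy0 i
    · by_cases h : i = j
      · subst h; simpa using hcx
      · simpa [h] using hyx i
    · rw [Finset.mem_insert, not_or] at hi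
      simpa [hi.1] using hyJ i hi.2
    · rw [Finset.sum_insert hj, Function.update_self,
        Finset.sum_congr rfl fun i hi => Function.update_of_ne (hne i hi) c y, ← hsum]
      abel

end Riesz

/-! ### Refinements of finite families by matrices over `ℕ`. -/

section Refinement

variable {G : Type*} [AddCommGroup G] {ι κ μ : Type*}

/-- Every `x i` is the combination of the `y k` with coefficients the `i`-th column of `M`. -/
def Refines [Fintype κ] (x : ι → G) (y : κ → G) (M : Matrix κ ι ℕ) : Prop :=
  ∀ i, x i = ∑ k, M k i • y k

/-- The action of a matrix of natural numbers on integer vectors. -/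
def natMulVec [Fintype ι] (M : Matrix κ ι ℕ) (v : ι → ℤ) : κ → ℤ :=
  (M.map (Nat.cast : ℕ → ℤ)).mulVec v

theorem natMulVec_apply [Fintype ι] (M : Matrix κ ι ℕ) (v : ι → ℤ) (k : κ) :
    natMulVec M v k = ∑ i, (M k i : ℤ) * v i := rfl

theorem natMulVec_mul [Fintype ι] [Fintype κ] (M : Matrix κ ι ℕ) (N : Matrix μ κ ℕ) (v : ι → ℤ) :
    natMulVec (N * M) v = natMulVec N (natMulVec M v) := by
  have h : (N * M).map (Nat.cast : ℕ → ℤ) =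
      N.map (Nat.cast : ℕ → ℤ) * M.map (Nat.cast : ℕ → ℤ) :=
    Matrix.map_mul (f := Nat.castRingHom ℤ)
  rw [natMulVec, h, ← Matrix.mulVec_mulVec]
  rfl

theorem natMulVec_one [Fintype ι] [DecidableEq ι] (v : ι → ℤ) : natMulVec (1 : Matrix ι ι ℕ) v = v := by
  ext k
  simp [natMulVec_apply, Matrix.one_apply]

theorem natMulVec_neg [Fintype ι] (M : Matrix κ ι ℕ) (v : ι → ℤ) : natMulVec M (-v) = -natMulVec M v :=
  Matrix.mulVec_neg _ _

theorem natMulVec_zero [Fintype ι] (M : Matrix κ ι ℕ) : natMulVec M 0 = 0 := Matrix.mulVec_zero _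

theorem Refines.refl [Fintype ι] [DecidableEq ι] (x : ι → G) : Refines x x 1 := by
  intro i
  simp [Matrix.one_apply, ite_smul]

theorem Refines.trans [Fintype κ] [Fintype μ] {x : ι → G} {y : κ → G} {z : μ → G} {M : Matrix κ ι ℕ}
    {N : Matrix μ κ ℕ} (h : Refines x y M) (h' : Refines y z N) : Refines x z (N * M) := by
  intro i
  rw [h i]
  simp only [h' _, Matrix.mul_apply, Finset.sum_smul, Finset.smul_sum, smul_smul]
  rw [Finset.sum_comm]
  simp only [mul_comm]

/-- This carries relations among the `x i` to relations among the `y k`, and makes the maps from the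
simplicial groups to `G` compatible with the connecting matrices. -/
theorem Refines.linearCombination [Fintype ι] [Fintype κ] {x : ι → G} {y : κ → G} {M : Matrix κ ι ℕ}
    (h : Refines x y M) (v : ι → ℤ) :
    Fintype.linearCombination ℤ y (natMulVec M v) = Fintype.linearCombination ℤ x v := by
  simp only [Fintype.linearCombination_apply, natMulVec_apply, Finset.sum_smul, h _,
    Finset.smul_sum]
  rw [Finset.sum_comm]
  refine Finset.sum_congr rfl fun i _ => Finset.sum_congr rfl fun k _ => ?_
  rw [mul_comm, mul_smul, natCast_zsmul]

end Refinement

/-! ### Killing relations by refinement (Shen's argument). -/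

section Kill

variable {G : Type*} [AddCommGroup G] [PartialOrder G] [IsOrderedAddMonoid G]

/-- If `v` is a relation among positive elements whose largest coefficient in absolute value `p`
is attained positively, some refinement transports `v` to a relation with fewer coefficients of
absolute value `p`. -/
theorem IsDimensionGroup.exists_refines_card_lt (hG : IsDimensionGroup G) {ι : Type}
    [Fintype ι] [DecidableEq ι] (x : ι → G) (hx : ∀ i, 0 ≤ x i) (v : ι → ℤ)
    (hv : Fintype.linearCombination ℤ x v = 0) (p : ℤ) (hp : 0 < p) (hvp : ∀ i, |v i| ≤ p)
    (i₀ : ι) (hi₀ : v i₀ = p) :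
    ∃ (y : ι ⊕ ι → G) (M : Matrix (ι ⊕ ι) ι ℕ), (∀ k, 0 ≤ y k) ∧ Refines x y M ∧
      (∀ k, |natMulVec M v k| ≤ p) ∧
      (Finset.univ.filter fun k => |natMulVec M v k| = p).card <
        (Finset.univ.filter fun i => |v i| = p).card := by
  classical
  set J : Finset ι := Finset.univ.filter fun i => v i < 0 with hJ
  have hiJ : i₀ ∉ J := by simp [hJ, hi₀, hp.le]
  -- Moving the negative terms across gives `p • x i₀ ≤ ∑ i ∈ J, (-v i) • x i ≤ p • ∑ i ∈ J, x i`;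
  -- unperforation cancels `p`.
  have hle : x i₀ ≤ ∑ i ∈ J, x i := by
    have h1 : p • x i₀ ≤ p • ∑ i ∈ J, x i := by
      have h2 : (∑ i ∈ J, v i • x i) + ∑ i ∈ Jᶜ, v i • x i = 0 := by
        rw [Finset.sum_add_sum_compl, ← hv, Fintype.linearCombination_apply]
      have h3 : p • x i₀ ≤ ∑ i ∈ Jᶜ, v i • x i := by
        rw [← hi₀]
        refine Finset.single_le_sum (f := fun i => v i • x i) (fun i hi => ?_)
          (Finset.mem_compl.2 hiJ)
        have : 0 ≤ v i := by simpa [hJ] using hi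
        exact zsmul_nonneg (hx i) this
      have h4 : ∑ i ∈ Jᶜ, v i • x i = ∑ i ∈ J, (-v i) • x i := by
        simp only [eq_neg_of_add_eq_zero_right h2, neg_smul, Finset.sum_neg_distrib]
      rw [Finset.smul_sum]
      refine h3.trans (h4.le.trans (Finset.sum_le_sum fun i _ => ?_))
      exact zsmul_le_zsmul_left (hx i) ((neg_le_abs _).trans (hvp i))
    have h5 : 0 ≤ p.toNat • (∑ i ∈ J, x i - x i₀) := by
      rw [← natCast_zsmul, Int.toNat_of_nonneg hp.le, smul_sub]
      exact sub_nonneg.2 h1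
    exact sub_nonneg.1 (hG.unperforated _ _ (by omega) h5)
  obtain ⟨y, hy0, hyx, hyJ, hsum⟩ := hG.exists_decomposition J x hx (x i₀) (hx i₀) hle
  -- With `x i₀ = ∑ i ∈ J, y i`, the generator `x i₀` is dropped and each other `x k` is split as `y
  -- k + (x k - y k)`. Unused slots get zero rows in `M`, so that `ι ⊕ ι` serves as index type
  -- whatever `J` is.
  let z : ι ⊕ ι → G := Sum.elim y fun k => if k = i₀ then 0 else x k - y k
  let M : Matrix (ι ⊕ ι) ι ℕ := fun k i => Sum.elim
    (fun k => if k ∈ J then (if i = i₀ then 1 else 0) + (if i = k then 1 else 0) else 0)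
    (fun k => if k = i₀ then 0 else if i = k then 1 else 0) k
  have hl : ∀ k, natMulVec M v (Sum.inl k) = if k ∈ J then p + v k else 0 := by
    intro k
    rw [natMulVec_apply]
    by_cases hk : k ∈ J <;> simp [M, hk, add_mul, Finset.sum_add_distrib, hi₀]
  have hr : ∀ k, natMulVec M v (Sum.inr k) = if k = i₀ then 0 else v k := by
    intro k
    rw [natMulVec_apply]
    by_cases hk : k = i₀ <;> simp [M, hk]
  -- On `J` the old coefficient lies in `[-p, 0)`, so `p + v k` lies in `[0, p)`. The new pieces
  -- thus never reach `p`, while the entry at `i₀` is lost.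
  have hlp : ∀ k, |natMulVec M v (Sum.inl k)| < p := by
    intro k
    rw [hl]
    split_ifs with hk
    · have h1 : v k < 0 := by simpa [hJ] using hk
      have h2 := abs_le.1 (hvp k)
      rw [abs_lt]; constructor <;> omega
    · simpa using hp
  refine ⟨z, M, ?_, ?_, ?_, ?_⟩
  · rintro (k | k)
    · exact hy0 k
    · by_cases hk : k = i₀
      · simp [z, hk]
      · simpa [z, hk] using hyx k
  · intro i
    rw [Fintype.sum_sum_type]
    by_cases hi : i = i₀
    · subst hi
      have h1 : ∀ k, M (Sum.inl k) i • z (Sum.inl k) = if k ∈ J then y k else 0 := by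
        intro k
        by_cases hk : k ∈ J
        · have : i ≠ k := fun h => hiJ (h ▸ hk)
          simp [M, z, hk, this]
        · simp [M, hk]
      have h2 : ∀ k, M (Sum.inr k) i • z (Sum.inr k) = 0 := by
        intro k
        by_cases hk : k = i
        · simp [M, hk]
        · simp [M, hk, Ne.symm hk]
      simp only [h1, h2, Finset.sum_const_zero, add_zero]
      rw [Finset.sum_ite_mem, Finset.univ_inter]
      exact hsum
    · have h1 : ∀ k, M (Sum.inl k) i • z (Sum.inl k) = if i = k then y k else 0 := by
        intro k
        by_cases hk : k ∈ J
        · by_cases hik : i = k <;> simp [M, z, hk, hik, hi]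
          simp [← hik, hi]
        · simp [M, hk, hyJ k hk]
      have h2 : ∀ k, M (Sum.inr k) i • z (Sum.inr k) = if i = k then x k - y k else 0 := by
        intro k
        by_cases hik : i = k
        · subst hik; simp [M, z, hi]
        · simp [M, hik]
      simp [h1, h2]
  · rintro (k | k)
    · exact (hlp k).le
    · rw [hr]
      split_ifs
      · simpa using hp.le
      · exact hvp k
  · have hsub : (Finset.univ.filter fun k => |natMulVec M v k| = p) ⊆
        ((Finset.univ.filter fun i => |v i| = p).erase i₀).map Function.Embedding.inr := by
      rintro (k | k) hk
      · exact absurd (by simpa using hk) (hlp k).ne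
      · rw [Finset.mem_filter, hr] at hk
        by_cases h : k = i₀
        · simp [h, hp.ne] at hk
        · simpa [h] using hk
    refine (Finset.card_le_card hsub).trans_lt ?_
    rw [Finset.card_map]
    exact Finset.card_erase_lt_of_mem (by simp [hi₀, hp.le])

/-- Every relation among positive elements vanishes in some positive refinement. -/
theorem IsDimensionGroup.exists_refines_natMulVec_eq_zero (hG : IsDimensionGroup G) (p : ℕ) :
    ∀ (ι : Type) [Fintype ι] [DecidableEq ι] (x : ι → G) (_ : ∀ i, 0 ≤ x i) (v : ι → ℤ)
      (_ : Fintype.linearCombination ℤ x v = 0) (_ : ∀ i, |v i| ≤ p),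
      ∃ (κ : Type) (_ : Fintype κ) (y : κ → G) (M : Matrix κ ι ℕ), (∀ k, 0 ≤ y k) ∧
        Refines x y M ∧ natMulVec M v = 0 := by
  classical
  induction p with
  | zero =>
    intro ι _ _ x hx v hv hvp
    refine ⟨ι, inferInstance, x, 1, hx, Refines.refl x, ?_⟩
    rw [natMulVec_one]
    ext i
    simpa using hvp i
  | succ p ihp =>
    -- Inner induction on the number of coefficients of maximal absolute value; when none remains,
    -- the bound drops to `p`.
    have key : ∀ (c : ℕ) (ι : Type) [Fintype ι] [DecidableEq ι] (x : ι → G)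
        (_ : ∀ i, 0 ≤ x i) (v : ι → ℤ) (_ : Fintype.linearCombination ℤ x v = 0)
        (_ : ∀ i, |v i| ≤ (p + 1 : ℤ))
        (_ : (Finset.univ.filter fun i => |v i| = (p + 1 : ℤ)).card ≤ c),
        ∃ (κ : Type) (_ : Fintype κ) (y : κ → G) (M : Matrix κ ι ℕ), (∀ k, 0 ≤ y k) ∧
          Refines x y M ∧ natMulVec M v = 0 := by
      intro c
      induction c with
      | zero =>
        intro ι _ _ x hx v hv hvp hc
        refine ihp ι x hx v hv fun i => ?_
        have h1 : |v i| ≠ (p + 1 : ℤ) := by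
          intro h
          have := Finset.card_eq_zero.1 (Nat.le_zero.1 hc)
          exact Finset.notMem_empty i (this ▸ (by simpa using h))
        have := hvp i
        omega
      | succ c ihc =>
        have aux : ∀ (ι : Type) [Fintype ι] [DecidableEq ι] (x : ι → G)
            (_ : ∀ i, 0 ≤ x i) (v : ι → ℤ) (_ : Fintype.linearCombination ℤ x v = 0)
            (_ : ∀ i, |v i| ≤ (p + 1 : ℤ))
            (_ : (Finset.univ.filter fun i => |v i| = (p + 1 : ℤ)).card ≤ c + 1)
            (i₀ : ι) (_ : v i₀ = p + 1),
            ∃ (κ : Type) (_ : Fintype κ) (y : κ → G) (M : Matrix κ ι ℕ), (∀ k, 0 ≤ y k) ∧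
              Refines x y M ∧ natMulVec M v = 0 := by
          intro ι _ _ x hx v hv hvp hc i₀ hi₀
          obtain ⟨y, M, hy, hM, hMp, hcard⟩ :=
            hG.exists_refines_card_lt x hx v hv (p + 1) (by omega) hvp i₀ hi₀
          obtain ⟨κ, _, z, N, hz, hN, h0⟩ := ihc (ι ⊕ ι) y hy (natMulVec M v)
            ((hM.linearCombination v).trans hv) hMp (by omega)
          exact ⟨κ, inferInstance, z, N * M, hz, hM.trans hN, by rw [natMulVec_mul, h0]⟩
        intro ι _ _ x hx v hv hvp hc
        by_cases h : ∃ i, |v i| = (p + 1 : ℤ)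
        · obtain ⟨i, hi⟩ := h
          -- If the maximum is attained negatively, `-v` is killed instead, by the same matrix.
          rcases (abs_eq (by omega)).1 hi with hi | hi
          · exact aux ι x hx v hv hvp hc i hi
          · obtain ⟨κ, _, y, M, hy, hM, h0⟩ := aux ι x hx (-v) (by rw [map_neg, hv, neg_zero])
              (by simpa using hvp) (by simpa using hc) i (by simp [hi])
            refine ⟨κ, inferInstance, y, M, hy, hM, ?_⟩
            rwa [natMulVec_neg, neg_eq_zero] at h0
        · refine ihp ι x hx v hv fun i => ?_
          have h1 : |v i| ≠ (p + 1 : ℤ) := fun hi => h ⟨i, hi⟩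
          have := hvp i
          omega
    intro ι _ _ x hx v hv hvp
    exact key _ ι x hx v hv (by simpa using hvp) le_rfl

/-- A finite family of positive elements has a positive refinement in which all of its relations
vanish. -/
theorem IsDimensionGroup.exists_refines_ker (hG : IsDimensionGroup G) {ι : Type} [Fintype ι]
    (x : ι → G) (hx : ∀ i, 0 ≤ x i) :
    ∃ (κ : Type) (_ : Fintype κ) (y : κ → G) (M : Matrix κ ι ℕ), (∀ k, 0 ≤ y k) ∧
      Refines x y M ∧ ∀ v, Fintype.linearCombination ℤ x v = 0 → natMulVec M v = 0 := by
  classical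
  have fin : ∀ S : Finset (ι → ℤ), (∀ v ∈ S, Fintype.linearCombination ℤ x v = 0) →
      ∃ (κ : Type) (_ : Fintype κ) (y : κ → G) (M : Matrix κ ι ℕ), (∀ k, 0 ≤ y k) ∧
        Refines x y M ∧ ∀ v ∈ S, natMulVec M v = 0 := by
    intro S
    induction S using Finset.induction_on with
    | empty => exact fun _ => ⟨ι, inferInstance, x, 1, hx, Refines.refl x, by simp⟩
    | insert w S _ ih =>
      intro hS
      obtain ⟨κ, _, y, M, hy, hM, h0⟩ := ih fun v hv => hS v (Finset.mem_insert_of_mem hv)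
      obtain ⟨μ, _, z, N, hz, hN, h1⟩ := hG.exists_refines_natMulVec_eq_zero
        (∑ k, (natMulVec M w k).natAbs) κ y hy (natMulVec M w)
        ((hM.linearCombination w).trans (hS w (Finset.mem_insert_self w S))) fun i => by
          rw [Int.abs_eq_natAbs]
          exact_mod_cast Finset.single_le_sum (f := fun k => (natMulVec M w k).natAbs)
            (fun _ _ => Nat.zero_le _) (Finset.mem_univ i)
      refine ⟨μ, inferInstance, z, N * M, hz, hM.trans hN, fun v hv => ?_⟩
      rw [natMulVec_mul]
      rcases Finset.mem_insert.1 hv with rfl | hv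
      · exact h1
      · rw [h0 v hv, natMulVec_zero]
  -- The relations form a finitely generated subgroup of `ι → ℤ`, so killing a finite generating set
  -- suffices; a relation once killed stays killed under further refinement.
  obtain ⟨S, hS⟩ := IsNoetherian.noetherian (LinearMap.ker (Fintype.linearCombination ℤ x))
  obtain ⟨κ, _, y, M, hy, hM, h0⟩ := fin S fun v hv =>
    LinearMap.mem_ker.1 (hS ▸ Submodule.subset_span hv)
  refine ⟨κ, inferInstance, y, M, hy, hM, fun v hv => ?_⟩
  have hle : Submodule.span ℤ (S : Set (ι → ℤ)) ≤
      LinearMap.ker (M.map (Nat.cast : ℕ → ℤ)).mulVecLin :=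
    Submodule.span_le.2 fun v hv => LinearMap.mem_ker.2 (h0 v hv)
  exact LinearMap.mem_ker.1 (hle (hS ▸ LinearMap.mem_ker.2 hv))

end Kill

/-! ### Cutting positive elements into pieces of equal trace. -/

section GoodTrace

variable {G : Type*} [AddCommGroup G] {t : G →+ ℝ}

theorem IsGoodTrace.exists_mem_Icc [PartialOrder G] (hg : IsGoodTrace t) {b : G} (hb : 0 ≤ b) {h : ℝ}
    (hr : h ∈ Set.range t) (h0 : 0 ≤ h) (hle : h ≤ t b) : ∃ y, 0 ≤ y ∧ y ≤ b ∧ t y = h := by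
  have : h ∈ t '' Set.Icc 0 b := by
    rw [hg b hb]
    exact ⟨hr, h0, hle⟩
  obtain ⟨y, hy, rfl⟩ := this
  exact ⟨y, hy.1, hy.2, rfl⟩

/-- For a faithful good trace, a positive element of trace `n * h` is a sum of `n` positive
elements of trace `h`. -/
theorem IsGoodTrace.exists_sum_eq [PartialOrder G] [IsOrderedAddMonoid G]
    (hg : IsGoodTrace t) (hf : IsFaithfulTrace t) {h : ℝ}
    (hr : h ∈ Set.range t) (h0 : 0 ≤ h) (n : ℕ) (x : G) (hx : 0 ≤ x) (hn : t x = n * h) :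
    ∃ y : Fin n → G, (∀ i, 0 ≤ y i) ∧ (∀ i, t (y i) = h) ∧ x = ∑ i, y i := by
  induction n generalizing x with
  | zero =>
    refine ⟨Fin.elim0, fun i => i.elim0, fun i => i.elim0, ?_⟩
    -- The leftover has trace 0, so faithfulness makes it vanish.
    simpa using hf x hx (by simpa using hn)
  | succ n ih =>
    obtain ⟨y, hy0, hyx, hty⟩ := hg.exists_mem_Icc hx hr h0 (by
      rw [hn]; push_cast; nlinarith [mul_nonneg (Nat.cast_nonneg (α := ℝ) n) h0])
    obtain ⟨z, hz0, hz, hsum⟩ := ih (x - y) (sub_nonneg.2 hyx) (by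
      rw [map_sub, hn, hty]; push_cast; ring)
    refine ⟨Fin.cons y z, fun i => ?_, fun i => ?_, ?_⟩
    · refine Fin.cases ?_ (fun i => ?_) i
      · simpa using hy0
      · simpa using hz0 i
    · refine Fin.cases ?_ (fun i => ?_) i
      · simpa using hty
      · simpa using hz i
    · rw [Fin.sum_univ_succ]
      simp only [Fin.cons_zero, Fin.cons_succ, ← hsum]
      abel

/-- A positive family whose traces are multiples of `h` refines to a positive family of
constant trace `h`. -/
theorem IsGoodTrace.exists_refines_const [PartialOrder G] [IsOrderedAddMonoid G]
    (hg : IsGoodTrace t) (hf : IsFaithfulTrace t) {h : ℝ}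
    (hr : h ∈ Set.range t) (h0 : 0 ≤ h) {ι : Type*} [Fintype ι] (x : ι → G)
    (hx : ∀ i, 0 ≤ x i) (hn : ∀ i, ∃ n : ℕ, t (x i) = n * h) :
    ∃ (n : ℕ) (y : Fin n → G) (M : Matrix (Fin n) ι ℕ), (∀ k, 0 ≤ y k) ∧ (∀ k, t (y k) = h) ∧
      Refines x y M := by
  classical
  choose n hn using hn
  choose y hy0 hty hsum using fun i => hg.exists_sum_eq hf hr h0 (n i) (x i) (hx i) (hn i)
  let e := Fintype.equivFin (Σ i, Fin (n i))
  refine ⟨_, fun k => y (e.symm k).1 (e.symm k).2, fun k i => if (e.symm k).1 = i then 1 else 0,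
    fun k => hy0 _ _, fun k => hty _ _, fun i => ?_⟩
  rw [e.symm.sum_comp (fun p : Σ i, Fin (n i) => (if p.1 = i then 1 else 0 : ℕ) • y p.1 p.2),
    Fintype.sum_sigma, Fintype.sum_eq_single i]
  · simpa using hsum i
  · intro j hj
    simp [hj]

/-- Two rational elements of a group of reals are multiples of a common element of it. -/
theorem AddSubgroup.exists_common_divisor (A : AddSubgroup ℝ) {a b : ℝ} (ha : a ∈ A) (hb : b ∈ A)
    (ha0 : 0 < a) (haq : ∃ q : ℚ, a = q) (hbq : ∃ q : ℚ, b = q) :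
    ∃ h ∈ A, 0 < h ∧ (∃ m : ℤ, a = m * h) ∧ ∃ m : ℤ, b = m * h := by
  obtain ⟨p, rfl⟩ := haq
  obtain ⟨q, rfl⟩ := hbq
  set m : ℤ := p.num * q.den with hm
  set n : ℤ := q.num * p.den with hn
  have hD : (0 : ℝ) < p.den * q.den := by
    exact_mod_cast Nat.mul_pos p.den_pos q.den_pos
  have hp : (p : ℝ) = m / (p.den * q.den) := by
    have h1 : (p.den : ℝ) ≠ 0 := by exact_mod_cast p.den_ne_zero
    have h2 : (q.den : ℝ) ≠ 0 := by exact_mod_cast q.den_ne_zero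
    rw [hm, Rat.cast_def p]
    push_cast
    field_simp
  have hq : (q : ℝ) = n / (p.den * q.den) := by
    have h1 : (p.den : ℝ) ≠ 0 := by exact_mod_cast p.den_ne_zero
    have h2 : (q.den : ℝ) ≠ 0 := by exact_mod_cast q.den_ne_zero
    rw [hn, Rat.cast_def q]
    push_cast
    field_simp
  have hm0 : m ≠ 0 := by
    rintro h
    rw [hp, h] at ha0
    simp at ha0
  -- Over the common denominator the two values are `m` and `n`; Bézout puts their gcd back in `A`.
  refine ⟨(Int.gcd m n : ℤ) / (p.den * q.den), ?_, ?_, ?_, ?_⟩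
  · have : (((Int.gcd m n : ℕ) : ℤ) : ℝ) / (p.den * q.den) =
        Int.gcdA m n • (p : ℝ) + Int.gcdB m n • (q : ℝ) := by
      rw [Int.gcd_eq_gcd_ab, hp, hq]
      push_cast
      simp only [zsmul_eq_mul]
      ring
    rw [this]
    exact A.add_mem (A.zsmul_mem ha _) (A.zsmul_mem hb _)
  · refine div_pos ?_ hD
    exact_mod_cast Int.gcd_pos_of_ne_zero_left n hm0
  · obtain ⟨k, hk⟩ := Int.gcd_dvd_left m n
    refine ⟨k, ?_⟩
    rw [hp]
    conv_lhs => rw [hk]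
    push_cast
    ring
  · obtain ⟨k, hk⟩ := Int.gcd_dvd_right m n
    refine ⟨k, ?_⟩
    rw [hq]
    conv_lhs => rw [hk]
    push_cast
    ring

/-- Pairwise common divisors are iterated. The positive value `a` starts the induction and keeps the
divisor positive even when every `t (x i)` is zero. -/
theorem IsRationalTrace.exists_common_divisor (hq : IsRationalTrace t) {ι : Type*}
    (s : Finset ι) (x : ι → G) {a : ℝ} (ha : a ∈ Set.range t) (ha0 : 0 < a) :
    ∃ h ∈ Set.range t, 0 < h ∧ (∃ m : ℤ, a = m * h) ∧ ∀ i ∈ s, ∃ m : ℤ, t (x i) = m * h := by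
  classical
  induction s using Finset.induction_on with
  | empty => exact ⟨a, ha, ha0, ⟨1, by simp⟩, by simp⟩
  | insert j s _ ih =>
    obtain ⟨h, ⟨g, rfl⟩, h0, ⟨m, hm⟩, hs⟩ := ih
    obtain ⟨h', hr, h0', ⟨k, hk⟩, ⟨l, hl⟩⟩ := t.range.exists_common_divisor (a := t g)
      (b := t (x j)) ⟨g, rfl⟩ ⟨x j, rfl⟩ h0 (hq g) (hq (x j))
    refine ⟨h', hr, h0', ⟨m * k, by rw [hm, hk]; push_cast; ring⟩, fun i hi => ?_⟩
    rcases Finset.mem_insert.1 hi with rfl | hi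
    · exact ⟨l, hl⟩
    · obtain ⟨n, hn⟩ := hs i hi
      exact ⟨n * k, by rw [hn, hk]; push_cast; ring⟩

end GoodTrace

/-! ### Families of constant trace and the inductive step. -/

section Step

variable {G : Type*} [AddCommGroup G] [PartialOrder G]

/-- A nonempty finite family of positive elements, all of the same positive trace. -/
structure TracedFamily (t : G →+ ℝ) where
  size : ℕ
  size_pos : 0 < size
  elt : Fin size → G
  val : ℝ
  val_pos : 0 < val
  elt_nonneg : ∀ i, 0 ≤ elt i
  trace_elt : ∀ i, t (elt i) = val

theorem TracedFamily.val_mem_range {t : G →+ ℝ} (F : TracedFamily t) : F.val ∈ Set.range t :=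
  ⟨_, F.trace_elt ⟨0, F.size_pos⟩⟩

/-- This is where equal column sums come from: `t` applied to the `j`-th refinement identity gives a
column sum equal to the ratio of the two trace values, which does not depend on `j`. -/
theorem TracedFamily.sum_col {t : G →+ ℝ} {F F' : TracedFamily t}
    {M : Matrix (Fin F'.size) (Fin F.size) ℕ} (h : Refines F.elt F'.elt M) (j : Fin F.size) :
    F.val = (∑ r, M r j : ℕ) * F'.val := by
  rw [← F.trace_elt j, h j, map_sum]
  simp only [map_nsmul, F'.trace_elt, nsmul_eq_mul]
  push_cast
  rw [Finset.sum_mul]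

theorem TracedFamily.trace_linearCombination {t : G →+ ℝ} (F : TracedFamily t)
    (v : Fin F.size → ℤ) :
    t (Fintype.linearCombination ℤ F.elt v) = (∑ k, v k : ℤ) * F.val := by
  rw [Fintype.linearCombination_apply, map_sum]
  simp only [map_zsmul, F.trace_elt, zsmul_eq_mul]
  push_cast
  rw [Finset.sum_mul]

/-- The inductive step: a traced family refines to one in which all its relations vanish and which
represents a given positive element. -/
theorem TracedFamily.exists_next [IsOrderedAddMonoid G] (hG : IsDimensionGroup G) {t : G →+ ℝ}
    (ht : IsTrace t) (hq : IsRationalTrace t) (hf : IsFaithfulTrace t) (hg : IsGoodTrace t)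
    (F : TracedFamily t) (g : G) :
    ∃ (F' : TracedFamily t) (M : Matrix (Fin F'.size) (Fin F.size) ℕ),
      Refines F.elt F'.elt M ∧
      (∀ v, Fintype.linearCombination ℤ F.elt v = 0 → natMulVec M v = 0) ∧
      (0 ≤ g → ∃ w, 0 ≤ w ∧ Fintype.linearCombination ℤ F'.elt w = g) := by
  classical
  obtain ⟨κ, _, y, M, hy, hM, hker⟩ := hG.exists_refines_ker F.elt F.elt_nonneg
  -- `g` is adjoined as an extra member, replaced by 0 when it is not positive so that the family
  -- stays positive.
  let z : Option κ → G := fun o => o.elim (if 0 ≤ g then g else 0) y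
  have hz : ∀ o, 0 ≤ z o := by
    rintro (_ | k)
    · by_cases h : 0 ≤ g <;> simp [z, h]
    · exact hy k
  let P : Matrix (Option κ) κ ℕ := fun o k => if o = some k then 1 else 0
  have hP : Refines y z P := by
    intro k
    simp [P, z, ite_smul]
  obtain ⟨h, hr, h0, -, hdiv⟩ := hq.exists_common_divisor Finset.univ z F.val_mem_range F.val_pos
  have hnat : ∀ o, ∃ n : ℕ, t (z o) = n * h := by
    intro o
    obtain ⟨m, hm⟩ := hdiv o (Finset.mem_univ o)
    have h1 : 0 ≤ (m : ℝ) * h := hm ▸ ht.1 _ (hz o)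
    have h2 : 0 ≤ m := by exact_mod_cast nonneg_of_mul_nonneg_left h1 h0
    lift m to ℕ using h2
    exact ⟨m, by simpa using hm⟩
  obtain ⟨n, e, N, he0, hte, hN⟩ := hg.exists_refines_const hf hr h0.le z hz hnat
  have hR : Refines F.elt e (N * (P * M)) := (hM.trans hP).trans hN
  have hn : 0 < n := by
    rcases Nat.eq_zero_or_pos n with rfl | hn
    · have h1 := F.trace_elt ⟨0, F.size_pos⟩
      rw [hR _] at h1
      simp only [Finset.univ_eq_empty, Finset.sum_empty, map_zero] at h1
      exact absurd h1 F.val_pos.ne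
    · exact hn
  refine ⟨⟨n, hn, e, h, h0, he0, hte⟩, N * (P * M), hR, fun v hv => ?_, fun hg0 => ?_⟩
  · rw [natMulVec_mul, natMulVec_mul, hker v hv, natMulVec_zero, natMulVec_zero]
  -- The column of `N` at the adjoined member expresses `g` in the new family.
  · refine ⟨fun k => N k none, fun k => Int.natCast_nonneg _, ?_⟩
    have h1 := hN none
    simp only [z, Option.elim_none, if_pos hg0] at h1
    rw [Fintype.linearCombination_apply, h1]
    simp only [natCast_zsmul]

end Step

/-! ### Recognizing an ordered group as the limit of a simplicial sequence. -/

section Limit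

namespace SimplicialSequence

variable {G : Type*} [AddCommGroup G]

theorem exists_eq_cls (S : SimplicialSequence) (x : S.Limit) : ∃ i v, x = S.cls i v :=
  DirectLimit.exists_eq_mk (f := S.trans) x

/-- The homomorphism from the limit induced by a compatible family of homomorphisms. -/
noncomputable def liftHom (S : SimplicialSequence) (f : ∀ i, S.Level i →+ G)
    (hf : ∀ i j (h : i ≤ j) v, f i v = f j (S.trans i j h v)) : S.Limit →+ G where
  toFun x := DirectLimit.lift S.trans (fun i v => f i v) (fun i j h v => hf i j h v) x
  map_zero' := DirectLimit.lift_zero (f := S.trans) f (fun i j h v => hf i j h v)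
  map_add' x y := DirectLimit.lift_add (f := S.trans) f (fun i j h v => hf i j h v) x y

/-- Compatible positive homomorphisms from the levels induce an isomorphism of ordered groups from
the limit, provided each kernel dies at the next level and all positive elements are reached. -/
theorem exists_orderAddMonoidIso [PartialOrder G] [IsOrderedAddMonoid G] (S : SimplicialSequence)
    (f : ∀ i, S.Level i →+ G)
    (hstep : ∀ i v, f (i + 1) (S.step i v) = f i v) (hpos : ∀ i v, 0 ≤ v → 0 ≤ f i v)
    (hker : ∀ i v, f i v = 0 → S.step i v = 0)
    (hsurj : ∀ g : G, 0 ≤ g → ∃ i v, 0 ≤ v ∧ f i v = g)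
    (hdir : ∀ g : G, ∃ a b : G, 0 ≤ a ∧ 0 ≤ b ∧ g = a - b) :
    ∃ e : G ≃+o S.Limit, ∀ i v, e (f i v) = S.cls i v := by
  have hf : ∀ i j (h : i ≤ j) v, f i v = f j (S.trans i j h v) := by
    intro i j h v
    induction h with
    | refl => simp [trans_self]
    | step h ih => rw [S.trans_succ h, AddMonoidHom.comp_apply, hstep, ih]
  let Φ : S.Limit →+ G := S.liftHom f hf
  have hΦ : ∀ i v, Φ (S.cls i v) = f i v := fun _ _ => rfl
  have hinj : Function.Injective Φ := by
    rw [injective_iff_map_eq_zero]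
    intro x hx
    obtain ⟨i, v, rfl⟩ := S.exists_eq_cls x
    rw [hΦ] at hx
    rw [← S.cls_trans (Nat.le_succ i), S.trans_succ le_rfl, trans_self]
    simp [hker i v hx, cls_zero]
  have hpre : ∀ g : G, 0 ≤ g → ∃ x, S.Pos x ∧ Φ x = g := by
    intro g hg
    obtain ⟨i, v, hv, rfl⟩ := hsurj g hg
    exact ⟨S.cls i v, ⟨i, v, hv, rfl⟩, rfl⟩
  have hbij : Function.Bijective Φ := by
    refine ⟨hinj, fun g => ?_⟩
    obtain ⟨a, b, ha, hb, rfl⟩ := hdir g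
    obtain ⟨x, -, rfl⟩ := hpre a ha
    obtain ⟨y, -, rfl⟩ := hpre b hb
    exact ⟨x - y, map_sub _ _ _⟩
  have hle : ∀ x y, x ≤ y ↔ Φ x ≤ Φ y := by
    intro x y
    rw [le_iff, ← sub_nonneg (a := Φ y), ← map_sub]
    constructor
    · rintro ⟨i, v, hv, h⟩
      rw [h, hΦ]
      exact hpos i v hv
    -- A positive element of `G` is the image of some positive class; by injectivity that class is
    -- the given difference.
    · intro h
      obtain ⟨z, hz, hzΦ⟩ := hpre _ h
      rwa [← hinj hzΦ]
  let e : S.Limit ≃+ G := AddEquiv.ofBijective Φ hbij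
  have he : ∀ x, e x = Φ x := fun _ => rfl
  refine ⟨{ e.symm with map_le_map_iff' := fun {a b} => ?_ }, fun i v => ?_⟩
  · change e.symm a ≤ e.symm b ↔ a ≤ b
    rw [hle, ← he, ← he, e.apply_symm_apply, e.apply_symm_apply]
  · change e.symm (f i v) = _
    rw [e.symm_apply_eq, he, hΦ]

end SimplicialSequence

end Limit

/-! ### Building the realization. -/

section Realization

variable {G : Type*} [AddCommGroup G] [PartialOrder G] [IsOrderedAddMonoid G] {t : G →+ ℝ}

/-- A faithful, good, rational trace on a countable dimension group is, up to any given positive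
value `h` of it, the trace associated to an ECS realization. -/
theorem IsDimensionGroup.exists_ecsRealization (hG : IsDimensionGroup G) [Countable G]
    (ht : IsTrace t) (hq : IsRationalTrace t) (hf : IsFaithfulTrace t) (hg : IsGoodTrace t)
    {h : ℝ} (hr : h ∈ Set.range t) (h0 : 0 < h) :
    ∃ R : ECSRealization G, ∀ g, t g = h * R.trace g := by
  -- Writing `g = a - b` gives `h ≤ t a`, so goodness finds an element of trace `h` below `a`.
  obtain ⟨x₀, hx₀, htx₀⟩ : ∃ x, 0 ≤ x ∧ t x = h := by
    obtain ⟨g, rfl⟩ := hr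
    obtain ⟨a, b, ha, hb, rfl⟩ := hG.directed g
    obtain ⟨x, hx, -, htx⟩ := hg.exists_mem_Icc ha ⟨_, rfl⟩ h0.le (by
      rw [map_sub]; linarith [ht.1 b hb])
    exact ⟨x, hx, htx⟩
  obtain ⟨γ, hγ⟩ := exists_surjective_nat G
  choose next M hM hker hcov using fun (F : TracedFamily t) (g : G) =>
    F.exists_next hG ht hq hf hg g
  -- The sequence starts from the single element `x₀`: the associated trace is 1 on the level 0
  -- basis vector, while `t` is `h` there, which fixes the factor `h`. Stage `i + 1` represents `γ
  -- i` if it is positive.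
  let F : ℕ → TracedFamily t := fun i => Nat.rec
    ⟨1, one_pos, fun _ => x₀, h, h0, fun _ => hx₀, fun _ => htx₀⟩ (fun i F => next F (γ i)) i
  have hF0 : (F 0).val = h := rfl
  let S : SimplicialSequence :=
    ⟨fun i => (F i).size, fun i => (F i).size_pos, fun i => M (F i) (γ i)⟩
  let c : ℕ → ℕ := fun i => ∑ r, S.mat i r ⟨0, S.size_pos i⟩
  have hval : ∀ i, (F i).val = c i * (F (i + 1)).val := fun i =>
    TracedFamily.sum_col (hM (F i) (γ i)) _
  have hcpos : ∀ i, 0 < c i := by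
    intro i
    refine Nat.pos_of_ne_zero fun h => ?_
    have := hval i
    rw [h, Nat.cast_zero, zero_mul] at this
    exact (F i).val_pos.ne' this
  let E : ECSSequence :=
    { S with
      colSum := c
      colSum_pos := hcpos
      sum_col := fun i j => by
        have h1 := (TracedFamily.sum_col (hM (F i) (γ i)) j).symm.trans (hval i)
        exact_mod_cast mul_right_cancel₀ (F (i + 1)).val_pos.ne' h1 }
  let f : ∀ i, S.Level i →+ G := fun i => (Fintype.linearCombination ℤ (F i).elt).toAddMonoidHom
  have hfe : ∀ i v, f i v = Fintype.linearCombination ℤ (F i).elt v := fun _ _ => rfl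
  obtain ⟨e, he⟩ := S.exists_orderAddMonoidIso f
    (fun i v => (hM (F i) (γ i)).linearCombination v)
    (fun i v hv => by
      rw [hfe, Fintype.linearCombination_apply]
      exact Finset.sum_nonneg fun k _ => zsmul_nonneg ((F i).elt_nonneg k) (hv k))
    (fun i v hv => hker (F i) (γ i) v hv)
    (fun g hg => by
      obtain ⟨i, rfl⟩ := hγ g
      obtain ⟨w, hw, hwg⟩ := hcov (F i) (γ i) hg
      exact ⟨i + 1, w, hw, hwg⟩)
    hG.directed
  -- Telescoping of `c i = (F i).val / (F (i + 1)).val`.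
  have hprod : ∀ i, h = (∏ j ∈ Finset.range i, (c j : ℝ)) * (F i).val := by
    intro i
    induction i with
    | zero => simp [hF0]
    | succ i ih => rw [Finset.prod_range_succ, mul_assoc, ← hval, ← ih]
  refine ⟨⟨E, e⟩, fun g => ?_⟩
  obtain ⟨i, v, hv⟩ := S.exists_eq_cls (e g)
  have hgv : g = f i v := EquivLike.injective e (by rw [he, hv])
  have h1 : ECSRealization.trace ⟨E, e⟩ g =
      ((∑ k, v k : ℤ) : ℝ) / ∏ j ∈ Finset.range i, (c j : ℝ) := by
    change E.trace (e g) = _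
    rw [hv]
    exact E.trace_cls i v
  have hc : (∏ j ∈ Finset.range i, (c j : ℝ)) ≠ 0 :=
    Finset.prod_ne_zero_iff.2 fun j _ => by exact_mod_cast (hcpos j).ne'
  rw [h1, hgv, hfe, (F i).trace_linearCombination, hprod i]
  field_simp
  exact mul_comm _ _

end Realization

/-! ### Traces of ECS realizations are faithful, good and rational. -/

section Converse

/-- Below a nonnegative integer vector, every intermediate coordinate sum is attained. -/
theorem exists_le_sum_eq {ι : Type*} (s : Finset ι) (v : ι → ℤ) (hv : 0 ≤ v) (m : ℤ)
    (h0 : 0 ≤ m) (hm : m ≤ ∑ i ∈ s, v i) :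
    ∃ w : ι → ℤ, 0 ≤ w ∧ w ≤ v ∧ ∑ i ∈ s, w i = m := by
  classical
  induction s using Finset.induction_on generalizing m with
  | empty => exact ⟨0, le_rfl, hv, by simp at hm ⊢; omega⟩
  | insert j s hj ih =>
    rw [Finset.sum_insert hj] at hm
    have hvj : 0 ≤ v j := hv j
    have hs : 0 ≤ ∑ i ∈ s, v i := Finset.sum_nonneg fun i _ => hv i
    -- Greedy choice: coordinate `j` takes as much of `m` as `v j` allows.
    obtain ⟨w, hw0, hwv, hsum⟩ := ih (m - min m (v j)) (by omega) (by omega)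
    refine ⟨Function.update w j (min m (v j)), fun i => ?_, fun i => ?_, ?_⟩
    · by_cases h : i = j
      · subst h; simp [h0, hvj]
      · simpa [h] using hw0 i
    · by_cases h : i = j
      · subst h; simp
      · simpa [h] using hwv i
    · have hne : ∀ i ∈ s, i ≠ j := fun i hi h => hj (h ▸ hi)
      rw [Finset.sum_insert hj, Function.update_self,
        Finset.sum_congr rfl fun i hi => Function.update_of_ne (hne i hi) _ w, hsum]
      ring

namespace ECSSequence

variable (E : ECSSequence)

theorem prod_colSum_pos (i : ℕ) : 0 < ∏ j ∈ Finset.range i, (E.colSum j : ℝ) :=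
  Finset.prod_pos fun j _ => by exact_mod_cast E.colSum_pos j

theorem trace_rational (x : E.Limit) : ∃ r : ℚ, E.trace x = r := by
  obtain ⟨i, v, rfl⟩ := E.exists_eq_cls x
  refine ⟨((∑ k, v k : ℤ) : ℚ) / ∏ j ∈ Finset.range i, (E.colSum j : ℚ), ?_⟩
  rw [E.trace_cls]
  push_cast
  rfl

theorem eq_zero_of_trace_eq_zero {x : E.Limit} (hx : 0 ≤ x) (h : E.trace x = 0) : x = 0 := by
  obtain ⟨i, v, hv, hxv⟩ := hx
  rw [sub_zero] at hxv
  subst hxv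
  rw [E.trace_cls, div_eq_zero_iff, or_iff_left (E.prod_colSum_pos i).ne'] at h
  have h1 : ∑ k, v k = 0 := by exact_mod_cast h
  have h2 : v = 0 := by
    ext k
    exact (Finset.sum_eq_zero_iff_of_nonneg fun k _ => hv k).1 h1 k (Finset.mem_univ k)
  rw [h2, E.cls_zero]

theorem trace_nonneg {x : E.Limit} (hx : 0 ≤ x) : 0 ≤ E.trace x := by
  obtain ⟨i, v, hv, hxv⟩ := hx
  rw [sub_zero] at hxv
  rw [hxv, E.trace_cls]
  refine div_nonneg ?_ (E.prod_colSum_pos i).le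
  exact_mod_cast Finset.sum_nonneg fun k _ => hv k

/-- At a common level the two traces have the same denominator, so the question is about integer
coordinate sums, and `exists_le_sum_eq` answers it. Only the trace of `x` has to be nonnegative, not
`x` itself. -/
theorem exists_mem_Icc_trace_eq {b x : E.Limit} (hb : 0 ≤ b) (h0 : 0 ≤ E.trace x)
    (hle : E.trace x ≤ E.trace b) : ∃ y, 0 ≤ y ∧ y ≤ b ∧ E.trace y = E.trace x := by
  obtain ⟨i, v, hv, hbv⟩ := hb
  rw [sub_zero] at hbv
  obtain ⟨j, w, rfl⟩ := E.exists_eq_cls x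
  set k := max i j
  rw [hbv, ← E.cls_trans (le_max_left i j)] at hle ⊢
  rw [← E.cls_trans (le_max_right i j)] at hle h0 ⊢
  have hv' : 0 ≤ E.trans i k (le_max_left i j) v := E.trans_nonneg _ hv
  generalize E.trans i k (le_max_left i j) v = v' at *
  generalize E.trans j k (le_max_right i j) w = w' at *
  have hD := E.prod_colSum_pos k
  rw [E.trace_cls, E.trace_cls, div_le_div_iff_of_pos_right hD] at hle
  rw [E.trace_cls, le_div_iff₀ hD, zero_mul] at h0
  have h0' : 0 ≤ ∑ l, w' l := by exact_mod_cast h0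
  obtain ⟨y, hy0, hyv, hsum⟩ := exists_le_sum_eq Finset.univ v' hv' (∑ l, w' l) h0'
    (by exact_mod_cast hle)
  refine ⟨E.cls k y, ⟨k, y, hy0, sub_zero _⟩, ⟨k, v' - y, sub_nonneg.2 hyv, ?_⟩, ?_⟩
  · rw [sub_eq_add_neg v', E.cls_add, E.cls_neg, sub_eq_add_neg]
  · rw [E.trace_cls, E.trace_cls, hsum]

end ECSSequence

variable {G : Type*} [AddCommGroup G] [PartialOrder G]

theorem ECSRealization.nonneg_iff (R : ECSRealization G) (g : G) : 0 ≤ R.iso g ↔ 0 ≤ g := by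
  rw [← map_zero R.iso, map_le_map_iff]

/-- A positive rational multiple of the trace associated to an ECS realization is faithful, good
and rational-valued. -/
theorem ECSRealization.faithful_good_rational [IsOrderedAddMonoid G] (R : ECSRealization G)
    {t : G →+ ℝ} {q : ℚ} (hq : 0 < q) (ht : ∀ g, t g = (q : ℝ) * R.trace g) :
    IsFaithfulTrace t ∧ IsGoodTrace t ∧ IsRationalTrace t := by
  have hq' : (0 : ℝ) < q := by exact_mod_cast hq
  replace ht : ∀ g, t g = (q : ℝ) * R.seq.trace (R.iso g) := ht
  refine ⟨fun g hg h => ?_, fun b hb => ?_, fun g => ?_⟩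
  · rw [ht, mul_eq_zero, or_iff_right hq'.ne'] at h
    have := R.seq.eq_zero_of_trace_eq_zero ((R.nonneg_iff g).2 hg) h
    exact EquivLike.injective R.iso (this.trans (map_zero R.iso).symm)
  · ext r
    constructor
    · rintro ⟨g, ⟨hg0, hgb⟩, rfl⟩
      refine ⟨⟨g, rfl⟩, ?_, ?_⟩
      · rw [ht]
        exact mul_nonneg hq'.le (R.seq.trace_nonneg ((R.nonneg_iff g).2 hg0))
      · rw [← sub_nonneg, ← map_sub, ht]
        exact mul_nonneg hq'.le (R.seq.trace_nonneg ((R.nonneg_iff _).2 (sub_nonneg.2 hgb)))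
    · rintro ⟨⟨g, rfl⟩, h0, hle⟩
      rw [ht] at h0
      rw [ht, ht, mul_le_mul_iff_right₀ hq'] at hle
      obtain ⟨y, hy0, hyb, hy⟩ := R.seq.exists_mem_Icc_trace_eq ((R.nonneg_iff b).2 hb)
        (nonneg_of_mul_nonneg_right h0 hq') hle
      obtain ⟨z, rfl⟩ := EquivLike.surjective R.iso y
      refine ⟨z, ⟨(R.nonneg_iff z).1 hy0, (map_le_map_iff R.iso).1 hyb⟩, ?_⟩
      rw [ht, hy, ht]
  · obtain ⟨r, hr⟩ := R.seq.trace_rational (R.iso g)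
    exact ⟨q * r, by rw [ht, hr]; push_cast; rfl⟩

end Converse

theorem theorem6p1 {G : Type*} [AddCommGroup G] [PartialOrder G] [IsOrderedAddMonoid G]
    (hG : IsDimensionGroup G) (u : G) (hu : IsOrderUnit u) (t : G →+ ℝ) (ht : IsTrace t) :
    (∀ (R : ECSRealization G) (q : ℚ), 0 < q → (∀ g : G, t g = (q : ℝ) * R.trace g) →
      IsFaithfulTrace t ∧ IsGoodTrace t ∧ IsRationalTrace t) ∧
    (Countable G → IsRationalTrace t → IsFaithfulTrace t → IsGoodTrace t →
      (∃ (R : ECSRealization G) (q : ℚ), 0 < q ∧ ∀ g : G, t g = (q : ℝ) * R.trace g) ∧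
      ((∃ g : G, t g = 1) → ∃ R : ECSRealization G, t = R.trace)) := by
  refine ⟨fun R q hq h => R.faithful_good_rational hq h, fun _ hq hf hg => ⟨?_, fun h1 => ?_⟩⟩
  · obtain ⟨g, hg0⟩ : ∃ g, 0 < t g := by
      obtain ⟨g, hne⟩ := DFunLike.ne_iff.1 ht.2
      rcases lt_or_gt_of_ne hne with h | h
      · exact ⟨-g, by simpa using h⟩
      · exact ⟨g, h⟩
    -- Any positive value of `t` can serve as `h`; being rational, it is the factor `q`. In the
    -- normalized case below, `h = 1`.
    obtain ⟨R, hR⟩ := hG.exists_ecsRealization ht hq hf hg ⟨g, rfl⟩ hg0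
    obtain ⟨q, hgq⟩ := hq g
    rw [hgq] at hg0 hR
    exact ⟨R, q, by exact_mod_cast hg0, hR⟩
  · obtain ⟨R, hR⟩ := hG.exists_ecsRealization ht hq hf hg h1 one_pos
    exact ⟨R, by ext g; simpa using hR g⟩
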